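/- All vector spaces are over $\mathbb{R}$, and a Fréchet space is a topological vector space that is metrizable, complete and locally convex. A short exact sequence $0\to H\stackrel{\imath}{\to} X\stackrel{\pi}{\to} G\to 0$ of topological abelian groups and group homomorphisms is called an extension of topological abelian groups if $\imath$ and $\pi$ are continuous and open onto their images; it is called an extension of topological vector spaces if moreover $H,X,G$ are topological vector spaces and $\imath,\pi$ are linear. **Theorem.** Let $E:\ 0\to Y\stackrel{\imath}{\to} X\stackrel{\pi}{\to} Z\to 0$ be an extension of topological abelian groups, where $Y$ is (the additive topological group of) a Fréchet space and $Z$ is (the additive topological group of) a metrizable topological vector space. Then $X$ is metrizable, and there is a scalar multiplication $\mathbb{R}\times X\to X$ which, together with the given addition and the given topology of $X$, makes $X$ a topological vector space and makes $E$, with the same maps $\imath$ and $\pi$, an extension of topological vector spaces. -/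

import Mathlib

/-- `0 → H → X → G → 0`, with maps `ι` and `π`, is an extension of topological abelian groups:
the sequence is exact, and both maps are continuous and open onto their images. -/
structure IsTopAddGroupExtension {H X G : Type*}
    [AddCommGroup H] [TopologicalSpace H] [AddCommGroup X] [TopologicalSpace X]
    [AddCommGroup G] [TopologicalSpace G] (ι : H →+ X) (π : X →+ G) : Prop where
  injective : Function.Injective ι
  exact : Function.Exact ι π
  surjective : Function.Surjective π
  continuous_left : Continuous ι
  continuous_right : Continuous π
  open_left : IsOpenMap ι.rangeRestrict
  open_right : IsOpenMap π.rangeRestrict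

/-- An extension `0 → Y → X → Z → 0` of (real) topological vector spaces: an extension of the
underlying topological abelian groups in which both maps are linear. -/
structure IsTVSExtension {Y X Z : Type*}
    [AddCommGroup Y] [Module ℝ Y] [TopologicalSpace Y]
    [AddCommGroup X] [Module ℝ X] [TopologicalSpace X]
    [AddCommGroup Z] [Module ℝ Z] [TopologicalSpace Z] (ι : Y →+ X) (π : X →+ Z) : Prop
    extends IsTopAddGroupExtension ι π where
  map_smul_left : ∀ (c : ℝ) (y : Y), ι (c • y) = c • ι y
  map_smul_right : ∀ (c : ℝ) (x : X), π (c • x) = c • π x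

/-! ### Almost additive sequences, seminorms and changes of scalars -/

open Filter Topology Set

/-! Multiplication by a nonzero integer is bijective on `Y` and `Z`, hence on `X`, so `X` is a
rational vector space. The crux is that rationals in `[-1, 1]` act equicontinuously at `0`
(`exists_nhds_rat_smul_mem`). For `x` near `0`, lift each `(k / n) • π x` to a small `f k`, with `f
n = x`. Then `f k - (k / n) • x` comes from some `g k` in `Y`; `g` is additive up to a small error
and `g n = 0`. A Hyers–Ulam type estimate in a seminorm of `Y` bounds `g` independently of `n`, so
`(k / n) • x = f k - ι (g k)` is small.

As `q` tends to a real `c`, `q • x` is then Cauchy and its image in `Z` converges, so it converges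
in `X` by completeness of `Y`. The rational action thus extends continuously to real scalars. -/

theorem Seminorm.le_of_locally_additive {Y : Type*} [AddCommGroup Y] [Module ℝ Y]
    (p : Seminorm ℝ Y) (g : ℕ → Y) (n : ℕ) (ε : ℝ) (hn : g n = 0)
    (h : ∀ k l, k + l ≤ n → p (g (k + l) - g k - g l) ≤ ε) (k : ℕ) (hk : k ≤ n) :
    p (g k) ≤ 3 * ε := by
  obtain ⟨m, hm, hmax⟩ := Finset.exists_max_image (Finset.range (n + 1)) (fun k => p (g k)) ⟨0, by simp⟩
  simp only [Finset.mem_range, Nat.lt_succ_iff] at hm hmax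
  have half : ∀ j, j + j ≤ n → 2 * p (g j) ≤ ε + p (g m) := by
    intro j hj
    have h1 := h j j hj
    have h2 : (2 : ℝ) • g j = g (j + j) - (g (j + j) - g j - g j) := by rw [two_smul]; abel
    have h3 : p ((2 : ℝ) • g j) = 2 * p (g j) := by rw [map_smul_eq_mul]; simp
    have h4 := map_sub_le_add p (g (j + j)) (g (j + j) - g j - g j)
    rw [← h2, h3] at h4
    linarith [hmax _ hj]
  have hε : 0 ≤ ε := (apply_nonneg p _).trans (h 0 0 (by simp))
  refine (hmax k hk).trans ?_
  -- At a maximizer `m` of `p ∘ g`, doubling gives the bound if `2 * m ≤ n`. Otherwise `n - m` can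
  -- be doubled, and `g n = 0` makes `g m` nearly `-g (n - m)`.
  by_cases hj : m + m ≤ n
  · linarith [half m hj]
  · have h1 := half (n - m) (by omega)
    have h2 := h (n - m) m (by omega)
    rw [Nat.sub_add_cancel hm, hn] at h2
    have h3 := map_sub_le_add p (-(0 - g (n - m) - g m)) (g (n - m))
    rw [map_neg_eq_map, show -(0 - g (n - m) - g m) - g (n - m) = g m by abel] at h3
    linarith

theorem exists_continuous_seminorm_ball_subset {Y : Type*} [AddCommGroup Y] [Module ℝ Y]
    [TopologicalSpace Y] [IsTopologicalAddGroup Y] [ContinuousSMul ℝ Y] [LocallyConvexSpace ℝ Y]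
    {U : Set Y} (hU : U ∈ 𝓝 0) : ∃ p : Seminorm ℝ Y, Continuous p ∧ ∀ y, p y < 1 → y ∈ U := by
  have hp := with_gaugeSeminormFamily (𝕜 := ℝ) (E := Y)
  obtain ⟨V, ⟨h0, ho, hb, hc⟩, hVU⟩ := (nhds_hasBasis_absConvex_open ℝ Y).mem_iff.1 hU
  let s : AbsConvexOpenSets ℝ Y := ⟨V, h0, ho, hb, hc⟩
  refine ⟨gaugeSeminormFamily ℝ Y s, hp.continuous_seminorm s, fun y hy => hVU ?_⟩
  have := gaugeSeminormFamily_ball (𝕜 := ℝ) s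
  have h2 : y ∈ (gaugeSeminormFamily ℝ Y s).ball 0 1 := by simpa [Seminorm.mem_ball_zero] using hy
  rw [this] at h2
  exact h2

/-- An abelian group on which all nonzero integers act bijectively is a rational vector space. -/
noncomputable abbrev Module.ratOfBijective {X : Type*} [AddCommGroup X]
    (h : ∀ n : ℤ, n ≠ 0 → Function.Bijective fun x : X => n • x) : Module ℚ X :=
  haveI : IsLocalizedModule (nonZeroDivisors ℤ) (LinearMap.id : X →ₗ[ℤ] X) :=
    { map_units := fun s => (Module.End.isUnit_iff _).2
        (h s (nonZeroDivisors.ne_zero s.2))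
      surj := fun x => ⟨(x, 1), by simp⟩
      exists_of_eq := fun hx => ⟨1, by simpa using hx⟩ }
  IsLocalizedModule.module (A := ℚ) (nonZeroDivisors ℤ) (LinearMap.id : X →ₗ[ℤ] X)

/-- A continuous extension of a rational scalar multiplication to real scalars is a real module
structure. -/
abbrev Module.realOfContinuousExtension {X : Type*} [AddCommGroup X] [TopologicalSpace X]
    [IsTopologicalAddGroup X] [T2Space X] [Module ℚ X] (m : ℝ → X → X)
    (hm : Continuous fun a : ℝ × X => m a.1 a.2) (hq : ∀ (q : ℚ) x, m q x = q • x) :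
    Module ℝ X :=
  have hm' : ∀ {α : Type} [TopologicalSpace α] {f : α → ℝ} {g : α → X}, Continuous f →
    Continuous g → Continuous fun a => m (f a) (g a) := fun hf hg => hm.comp (hf.prodMk hg)
  have dense : DenseRange (Rat.cast : ℚ → ℝ) := Rat.isDenseEmbedding_coe_real.dense
  { smul := m
    one_smul := fun x => by
      have h := hq 1 x
      rw [Rat.cast_one, one_smul] at h
      exact h
    mul_smul := fun a b x => by
      refine dense.induction_on₂ (p := fun a b => m (a * b) x = m a (m b x))
        (isClosed_eq (hm' (by fun_prop) (by fun_prop))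
          (hm' (by fun_prop) (hm' (by fun_prop) (by fun_prop)))) (fun q r => ?_) a b
      rw [← Rat.cast_mul, hq, hq, hq, mul_smul]
    smul_zero := fun a => by
      refine dense.induction_on (p := fun a => m a 0 = 0) a
        (isClosed_eq (hm' (by fun_prop) (by fun_prop)) (by fun_prop)) (fun q => ?_)
      rw [hq, smul_zero]
    smul_add := fun a x y => by
      refine dense.induction_on (p := fun a => m a (x + y) = m a x + m a y) a
        (isClosed_eq (hm' (by fun_prop) (by fun_prop))
          ((hm' (by fun_prop) (by fun_prop)).add (hm' (by fun_prop) (by fun_prop))))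
        (fun q => ?_)
      rw [hq, hq, hq, smul_add]
    add_smul := fun a b x => by
      refine dense.induction_on₂ (p := fun a b => m (a + b) x = m a x + m b x)
        (isClosed_eq (hm' (by fun_prop) (by fun_prop))
          ((hm' (by fun_prop) (by fun_prop)).add (hm' (by fun_prop) (by fun_prop))))
        (fun q r => ?_) a b
      rw [← Rat.cast_add, hq, hq, hq, add_smul]
    zero_smul := fun x => by
      have h := hq 0 x
      rw [Rat.cast_zero, zero_smul] at h
      exact h }

theorem AddMonoidHom.map_rat_smul_real {X Z : Type*} [AddCommGroup X] [Module ℚ X]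
    [AddCommGroup Z] [Module ℝ Z] (f : X →+ Z) (q : ℚ) (x : X) :
    f (q • x) = (q : ℝ) • f x := by
  simpa using map_ratCast_smul f ℚ ℝ q x

theorem AddMonoidHom.map_real_smul_rat {Y X : Type*} [AddCommGroup Y] [Module ℝ Y]
    [AddCommGroup X] [Module ℚ X] (f : Y →+ X) (q : ℚ) (y : Y) :
    f ((q : ℝ) • y) = q • f y := by
  simpa using map_ratCast_smul f ℝ ℚ q y

namespace IsTopAddGroupExtension

/-! ### Divisibility and countability at zero in the extension -/

section Group

variable {Y X Z : Type*} [AddCommGroup Y] [TopologicalSpace Y] [AddCommGroup X]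
  [TopologicalSpace X] [AddCommGroup Z] [TopologicalSpace Z] {ι : Y →+ X} {π : X →+ Z}

theorem exists_left (hE : IsTopAddGroupExtension ι π) {x : X} (hx : π x = 0) : ∃ y, ι y = x :=
  (hE.exact x).1 hx

theorem right_left (hE : IsTopAddGroupExtension ι π) (y : Y) : π (ι y) = 0 :=
  (hE.exact _).2 ⟨y, rfl⟩

theorem isInducing_left (hE : IsTopAddGroupExtension ι π) : IsInducing ι := by
  have h1 : IsInducing ι.rangeRestrict := by
    refine (IsOpenEmbedding.of_continuous_injective_isOpenMap
      (hE.continuous_left.subtype_mk _) ?_ hE.open_left).isInducing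
    intro a b hab
    exact hE.injective (congrArg Subtype.val hab)
  exact IsInducing.subtypeVal.comp h1

theorem isOpenMap_right (hE : IsTopAddGroupExtension ι π) : IsOpenMap π := by
  have h : IsOpen (π.range : Set Z) := by
    rw [AddMonoidHom.range_eq_top.2 hE.surjective]; exact isOpen_univ
  exact h.isOpenMap_subtype_val.comp hE.open_right

theorem image_mem_nhds_zero (hE : IsTopAddGroupExtension ι π) {U : Set X} (hU : U ∈ 𝓝 0) :
    π '' U ∈ 𝓝 0 := by
  simpa using hE.isOpenMap_right.image_mem_nhds hU

theorem preimage_mem_nhds_zero (hE : IsTopAddGroupExtension ι π) {U : Set X} (hU : U ∈ 𝓝 0) :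
    ι ⁻¹' U ∈ 𝓝 0 :=
  hE.continuous_left.continuousAt.preimage_mem_nhds (by simpa using hU)

theorem t0Space [T0Space Y] [T0Space Z] [IsTopologicalAddGroup X]
    (hE : IsTopAddGroupExtension ι π) : T0Space X := by
  refine ⟨fun x x' h => sub_eq_zero.1 ?_⟩
  have h0 : Inseparable (x - x') 0 := by simpa using h.map (continuous_sub_right x')
  have h1 : π (x - x') = 0 := by simpa using (h0.map hE.continuous_right).eq
  obtain ⟨y, hy⟩ := hE.exists_left h1
  rw [← hy, ← map_zero ι, hE.isInducing_left.inseparable_iff] at h0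
  rw [← hy, h0.eq, map_zero]

/-- The five lemma for multiplication by `n`, which is invertible on `Y` and `Z`. -/
theorem bijective_zsmul [Module ℝ Y] [Module ℝ Z] (hE : IsTopAddGroupExtension ι π) (n : ℤ)
    (hn : n ≠ 0) : Function.Bijective fun x : X => n • x := by
  have hn' : (n : ℝ) ≠ 0 := by exact_mod_cast hn
  constructor
  · intro a b hab
    have h0 : n • (a - b) = 0 := by rw [smul_sub]; exact sub_eq_zero.2 hab
    have h1 : π (a - b) = 0 := by
      have := congrArg π h0
      rw [map_zsmul, map_zero, ← Int.cast_smul_eq_zsmul ℝ] at this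
      exact (smul_eq_zero.1 this).resolve_left hn'
    obtain ⟨y, hy⟩ := hE.exists_left h1
    rw [← hy, ← map_zsmul, ← map_zero ι] at h0
    have h2 := hE.injective h0
    rw [← Int.cast_smul_eq_zsmul ℝ] at h2
    rw [(smul_eq_zero.1 h2).resolve_left hn', map_zero] at hy
    exact sub_eq_zero.1 hy.symm
  · intro x
    obtain ⟨w, hw⟩ := hE.surjective ((n : ℝ)⁻¹ • π x)
    obtain ⟨y, hy⟩ := hE.exists_left (x := x - n • w) (by
      rw [map_sub, map_zsmul, hw, ← Int.cast_smul_eq_zsmul ℝ, smul_inv_smul₀ hn', sub_self])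
    refine ⟨w + ι ((n : ℝ)⁻¹ • y), ?_⟩
    simp only
    rw [smul_add, ← map_zsmul, ← Int.cast_smul_eq_zsmul ℝ n ((n : ℝ)⁻¹ • y),
      smul_inv_smul₀ hn', hy, add_sub_cancel]

theorem isCountablyGenerated_nhds_zero [IsTopologicalAddGroup X] [(𝓝 (0 : Y)).IsCountablyGenerated]
    [(𝓝 (0 : Z)).IsCountablyGenerated] (hE : IsTopAddGroupExtension ι π) :
    (𝓝 (0 : X)).IsCountablyGenerated := by
  obtain ⟨B, hB⟩ := (𝓝 (0 : Y)).exists_antitone_basis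
  have key : ∀ k, ∃ A ∈ 𝓝 (0 : X), ∀ y, ∀ a ∈ A, ∀ b ∈ A, ι y = a - b → y ∈ B k := by
    intro k
    have h1 : B k ∈ comap ι (𝓝 0) := by
      have := hE.isInducing_left.nhds_eq_comap 0
      rw [map_zero] at this
      rw [← this]; exact hB.mem k
    obtain ⟨O, hO, hOB⟩ := h1
    have h2 : Tendsto (fun p : X × X => p.1 - p.2) (𝓝 0 ×ˢ 𝓝 0) (𝓝 0) := by
      rw [← nhds_prod_eq]
      simpa using! (continuous_sub (G := X)).tendsto (0, 0)
    obtain ⟨A, hA, hAO⟩ := mem_prod_same_iff.1 (h2 hO)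
    refine ⟨A, hA, fun y a ha b hb hy => hOB ?_⟩
    have : (a, b) ∈ A ×ˢ A := ⟨ha, hb⟩
    simpa [hy] using! hAO this
  choose A hA hAB using key
  -- A point of `A k` whose image in `Z` is small differs from a small point of `A k` by an element
  -- of `ι (B k)`; so the sets `A k` and the neighbourhoods pulled back from `Z` determine the
  -- topology at `0`.
  have : 𝓝 (0 : X) = (⨅ k, 𝓟 (A k)) ⊓ comap π (𝓝 0) := by
    refine le_antisymm (le_inf (le_iInf fun k => le_principal_iff.2 (hA k)) ?_) ?_
    · have := hE.continuous_right.tendsto 0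
      rw [map_zero] at this
      exact this.le_comap
    · intro O hO
      have h2 : Tendsto (fun p : X × X => p.1 + p.2) (𝓝 0 ×ˢ 𝓝 0) (𝓝 0) := by
        rw [← nhds_prod_eq]
        simpa using! (continuous_add (M := X)).tendsto (0, 0)
      obtain ⟨O', hO', hOO⟩ := mem_prod_same_iff.1 (h2 hO)
      obtain ⟨k, hk⟩ := hB.mem_iff.1 (hE.preimage_mem_nhds_zero hO')
      have h3 : A k ∩ π ⁻¹' (π '' (O' ∩ A k)) ∈ (⨅ k, 𝓟 (A k)) ⊓ comap π (𝓝 0) :=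
        inter_mem_inf (mem_iInf_of_mem k (mem_principal_self _))
          (preimage_mem_comap (hE.image_mem_nhds_zero (inter_mem hO' (hA k))))
      refine mem_of_superset h3 ?_
      rintro x ⟨hx, u, ⟨huO, huA⟩, hu⟩
      obtain ⟨y, hy⟩ := hE.exists_left (x := x - u) (by rw [map_sub, hu, sub_self])
      have h4 := hk (hAB k y x hx u huA hy)
      have h5 : (ι y, u) ∈ O' ×ˢ O' := ⟨h4, huO⟩
      simpa [hy] using! hOO h5
  rw [this]
  infer_instance

end Group

/-! ### Equicontinuity of rational multiplication -/

section RatSMul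

variable {Y X Z : Type*} [AddCommGroup Y] [Module ℝ Y] [TopologicalSpace Y]
  [IsTopologicalAddGroup Y] [ContinuousSMul ℝ Y]
  [AddCommGroup X] [TopologicalSpace X] [IsTopologicalAddGroup X] [Module ℚ X]
  [AddCommGroup Z] [Module ℝ Z] [TopologicalSpace Z]
  [ContinuousSMul ℝ Z] {ι : Y →+ X} {π : X →+ Z}

theorem exists_nhds_rat_smul_mem_of_nonneg [LocallyConvexSpace ℝ Y]
    (hE : IsTopAddGroupExtension ι π) {U : Set X} (hU : U ∈ 𝓝 0) :
    ∃ V ∈ 𝓝 (0 : X), ∀ q : ℚ, 0 ≤ q → q ≤ 1 → ∀ x ∈ V, q • x ∈ U := by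
  have hadd : Tendsto (fun p : X × X => p.1 - p.2) (𝓝 0 ×ˢ 𝓝 0) (𝓝 0) := by
    rw [← nhds_prod_eq]
    simpa using! (continuous_sub (G := X)).tendsto (0, 0)
  obtain ⟨W, hW, hWU⟩ := mem_prod_same_iff.1 (hadd hU)
  obtain ⟨p, hp, hpW⟩ := exists_continuous_seminorm_ball_subset (hE.preimage_mem_nhds_zero hW)
  -- Any bound below `1 / 3` works, since the estimate on `g` loses a factor `3` and must stay below
  -- `1`.
  have hball : {y | p y < 1 / 5} ∈ comap ι (𝓝 0) := by
    have h1 := hE.isInducing_left.nhds_eq_comap 0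
    rw [map_zero] at h1
    rw [← h1]
    exact (isOpen_lt hp continuous_const).mem_nhds (by simp)
  obtain ⟨O, hO, hOp⟩ := hball
  have hsub : Tendsto (fun p : (X × X) × X => p.1.1 - p.1.2 - p.2)
      ((𝓝 0 ×ˢ 𝓝 0) ×ˢ 𝓝 0) (𝓝 0) := by
    rw [← nhds_prod_eq, ← nhds_prod_eq]
    have : Continuous (fun p : (X × X) × X => p.1.1 - p.1.2 - p.2) := by fun_prop
    simpa using! this.tendsto ((0, 0), 0)
  obtain ⟨S, hS, T, hT, hST⟩ := mem_prod_iff.1 (hsub hO)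
  obtain ⟨R, hR, hRS⟩ := mem_prod_same_iff.1 hS
  let A := R ∩ T ∩ W
  have hA : A ∈ 𝓝 (0 : X) := inter_mem (inter_mem hR hT) hW
  have hAp : ∀ y, ∀ a ∈ A, ∀ b ∈ A, ∀ c ∈ A, ι y = a - b - c → p y ≤ 1 / 5 := by
    intro y a ha b hb c hc hy
    have h1 : ((a, b), c) ∈ S ×ˢ T := ⟨hRS ⟨ha.1.1, hb.1.1⟩, hc.1.2⟩
    have h2 : ι y ∈ O := by rw [hy]; exact hST h1
    exact (show p y < 1 / 5 from hOp h2).le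
  -- Balancedness keeps every `(k / n) • π x` inside `π '' A`, hence liftable to `A`.
  obtain ⟨V, ⟨hV, hVb⟩, hVA⟩ := (nhds_basis_balanced ℝ Z).mem_iff.1 (hE.image_mem_nhds_zero hA)
  have hπV : π ⁻¹' V ∈ 𝓝 (0 : X) :=
    hE.continuous_right.continuousAt.preimage_mem_nhds (by simpa using hV)
  refine ⟨A ∩ π ⁻¹' V, inter_mem hA hπV, fun q hq0 hq1 x hx => ?_⟩
  set n := q.den
  have hn : (0 : ℚ) < n := by exact_mod_cast q.den_pos
  have lift : ∀ k : ℕ, ∃ f : X, k ≤ n →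
      f ∈ A ∧ π f = π (((k : ℚ) / n) • x) ∧ (k = n → f = x) := by
    intro k
    by_cases hk : k ≤ n
    · by_cases hkn : k = n
      · refine ⟨x, fun _ => ⟨hx.1, ?_, fun _ => rfl⟩⟩
        rw [hkn, div_self hn.ne', one_smul]
      · have : (((k : ℚ) / n : ℚ) : ℝ) • π x ∈ V := by
          refine hVb.smul_mem ?_ hx.2
          rw [Real.norm_eq_abs, abs_le]
          have h0 : 0 ≤ (k : ℚ) / n := by positivity
          have h1 : (k : ℚ) / n ≤ 1 := (div_le_one hn).2 (by exact_mod_cast hk)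
          have h0' : (0 : ℝ) ≤ ((k : ℚ) / n : ℚ) := by exact_mod_cast h0
          have h1' : (((k : ℚ) / n : ℚ) : ℝ) ≤ 1 := by exact_mod_cast h1
          exact ⟨by linarith, h1'⟩
        obtain ⟨a, ha, hax⟩ := hVA this
        exact ⟨a, fun _ => ⟨ha, by rw [hax, AddMonoidHom.map_rat_smul_real], fun h => (hkn h).elim⟩⟩
    · exact ⟨0, fun h => (hk h).elim⟩
  choose f hf using lift
  have hg : ∀ k, ∃ y, k ≤ n → ι y = f k - ((k : ℚ) / n) • x := by
    intro k
    by_cases hk : k ≤ n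
    · obtain ⟨y, hy⟩ := hE.exists_left (x := f k - ((k : ℚ) / n) • x) (by
        rw [map_sub, (hf k hk).2.1, sub_self])
      exact ⟨y, fun _ => hy⟩
    · exact ⟨0, fun h => (hk h).elim⟩
  choose g hg using hg
  have hgn : g n = 0 := hE.injective (by
    rw [hg n le_rfl, (hf n le_rfl).2.2 rfl, div_self hn.ne', one_smul, sub_self, map_zero])
  -- The multiples of `x` cancel, leaving only the additivity defect of `f`, whose values lie in
  -- `A`.
  have hgadd : ∀ k l, k + l ≤ n → p (g (k + l) - g k - g l) ≤ 1 / 5 := by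
    intro k l hkl
    refine hAp _ (f (k + l)) (hf _ hkl).1 (f k) (hf k (by omega)).1 (f l) (hf l (by omega)).1 ?_
    rw [map_sub, map_sub, hg _ hkl, hg k (by omega), hg l (by omega)]
    push_cast
    rw [add_div, add_smul]
    abel
  obtain ⟨m, hm⟩ := Int.eq_ofNat_of_zero_le (Rat.num_nonneg.2 hq0)
  have hqm : q = (m : ℚ) / n := by
    conv_lhs => rw [← Rat.num_div_den q]
    rw [hm]; simp [n]
  have hmn : m ≤ n := by
    rw [hqm, div_le_one hn] at hq1
    exact_mod_cast hq1
  have hpm := p.le_of_locally_additive g n _ hgn hgadd m hmn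
  have hW' : ι (g m) ∈ W := hpW _ (hpm.trans_lt (by norm_num))
  have h1 : (f m, ι (g m)) ∈ W ×ˢ W := ⟨(hf m hmn).1.2, hW'⟩
  have h2 := hWU h1
  simpa [hg m hmn, ← hqm] using! h2

theorem exists_nhds_rat_smul_mem [LocallyConvexSpace ℝ Y]
    (hE : IsTopAddGroupExtension ι π) {U : Set X} (hU : U ∈ 𝓝 0) :
    ∃ V ∈ 𝓝 (0 : X), ∀ q : ℚ, |q| ≤ 1 → ∀ x ∈ V, q • x ∈ U := by
  obtain ⟨V, hV, h⟩ := hE.exists_nhds_rat_smul_mem_of_nonneg hU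
  refine ⟨V ∩ -V, inter_mem hV (neg_mem_nhds_zero X hV), fun q hq x hx => ?_⟩
  rcases le_total 0 q with h0 | h0
  · exact h q h0 (abs_le.1 hq).2 x hx.1
  · have := h (-q) (by linarith) (by linarith [(abs_le.1 hq).1]) (-x) hx.2
    simpa using this

/-- Multiplication by a rational parameter which stays bounded is equicontinuous at `0`. -/
theorem tendsto_rat_smul_zero_of_bounded [LocallyConvexSpace ℝ Y]
    (hE : IsTopAddGroupExtension ι π) {α : Type*} {l : Filter α} {q : α → ℚ} {x : α → X} (N : ℕ)
    (hq : ∀ᶠ a in l, |q a| ≤ N) (hx : Tendsto x l (𝓝 0)) :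
    Tendsto (fun a => q a • x a) l (𝓝 0) := by
  intro U hU
  obtain ⟨V, hV, h⟩ := hE.exists_nhds_rat_smul_mem hU
  have h2 : Tendsto (fun a => (N + 1) • x a) l (𝓝 0) := by
    simpa using hx.const_smul (N + 1)
  refine mem_map.2 ?_
  filter_upwards [hq, h2.eventually_mem hV] with a ha hxa
  -- The factor `N + 1`, nonzero even for `N = 0`, is moved from the scalar onto the vector.
  have hN : (0 : ℚ) < (N + 1 : ℕ) := by positivity
  have h3 := h (q a / (N + 1 : ℕ)) (by
    rw [abs_div, abs_of_pos hN, div_le_one hN]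
    push_cast; linarith) _ hxa
  rwa [← Nat.cast_smul_eq_nsmul ℚ, smul_smul, div_mul_cancel₀ _ hN.ne'] at h3

/-- Equicontinuity does not apply directly, as `x` need not be small. But `x = (n + 1) • v + ι y`
with `v` small, since `π x / (n + 1)` tends to `0` and `π` is open; both summands are then
controlled. -/
theorem tendsto_rat_smul_const [LocallyConvexSpace ℝ Y]
    (hE : IsTopAddGroupExtension ι π) {α : Type*} {l : Filter α} {q : α → ℚ}
    (hq : Tendsto (fun a => (q a : ℝ)) l (𝓝 0)) (x : X) :
    Tendsto (fun a => q a • x) l (𝓝 0) := by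
  intro U hU
  have hadd : Tendsto (fun p : X × X => p.1 + p.2) (𝓝 0 ×ˢ 𝓝 0) (𝓝 0) := by
    rw [← nhds_prod_eq]
    simpa using! (continuous_add (M := X)).tendsto (0, 0)
  obtain ⟨W, hW, hWU⟩ := mem_prod_same_iff.1 (hadd hU)
  obtain ⟨V, hV, h⟩ := hE.exists_nhds_rat_smul_mem hW
  have hinv : Tendsto (fun n : ℕ => ((n : ℝ) + 1)⁻¹ • π x) atTop (𝓝 0) := by
    have := (tendsto_one_div_add_atTop_nhds_zero_nat (𝕜 := ℝ)).smul_const (π x)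
    simpa using this
  obtain ⟨n, v, hv, hvx⟩ := (hinv.eventually_mem (hE.image_mem_nhds_zero hV)).exists
  have hn : (n : ℝ) + 1 ≠ 0 := by positivity
  obtain ⟨y, hy⟩ := hE.exists_left (x := x - (n + 1) • v) (by
    rw [map_sub, map_nsmul, hvx, ← Nat.cast_smul_eq_nsmul ℝ]
    push_cast
    rw [smul_inv_smul₀ hn, sub_self])
  have hy0 : Tendsto (fun a => ι ((q a : ℝ) • y)) l (𝓝 0) := by
    have h1 : Tendsto (fun a => (q a : ℝ) • y) l (𝓝 0) := by simpa using hq.smul_const y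
    simpa [Function.comp_def] using (hE.continuous_left.tendsto 0).comp h1
  have hqn : ∀ᶠ a in l, |(q a : ℝ) * (n + 1)| ≤ 1 := by
    have h1 : Tendsto (fun a => |(q a : ℝ) * (n + 1)|) l (𝓝 0) := by
      simpa using (hq.mul_const ((n : ℝ) + 1)).abs
    exact (h1.eventually_lt_const one_pos).mono fun _ => le_of_lt
  refine mem_map.2 ?_
  filter_upwards [hy0.eventually_mem hW, hqn] with a ha1 ha2
  have h2 := h (q a * (n + 1 : ℕ)) (by exact_mod_cast ha2) v hv
  have h3 : (ι ((q a : ℝ) • y), (q a * (n + 1 : ℕ)) • v) ∈ W ×ˢ W := ⟨ha1, h2⟩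
  have h4 := hWU h3
  have h5 : q a • x = ι ((q a : ℝ) • y) + (q a * (n + 1 : ℕ)) • v := by
    rw [AddMonoidHom.map_real_smul_rat, hy, mul_smul, Nat.cast_smul_eq_nsmul, smul_sub,
      sub_add_cancel]
  change q a • x ∈ U
  rw [h5]
  exact h4

end RatSMul

/-! ### Completeness and extension to real scalars -/

section Complete

/-- A Cauchy filter on an extension by a complete group converges as soon as its image in the
quotient converges. -/
theorem exists_le_nhds_of_cauchy {Y X Z : Type*} [AddCommGroup Y] [UniformSpace Y]
    [IsUniformAddGroup Y] [CompleteSpace Y] [AddCommGroup X] [UniformSpace X] [IsUniformAddGroup X]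
    [AddCommGroup Z] [TopologicalSpace Z] [IsTopologicalAddGroup Z] {ι : Y →+ X} {π : X →+ Z}
    (hE : IsTopAddGroupExtension ι π) {F : Filter X} (hF : Cauchy F) {z : Z}
    (hz : Tendsto π F (𝓝 z)) : ∃ x, F ≤ 𝓝 x := by
  obtain ⟨w, rfl⟩ := hE.surjective z
  have hG : Cauchy (map (fun x => x - w) F) := hF.map (uniformContinuous_id.sub uniformContinuous_const)
  set G := map (fun x => x - w) F
  have hGπ : Tendsto π G (𝓝 0) := by
    refine tendsto_map'_iff.2 ?_
    simpa [Function.comp_def] using hz.sub_const (π w)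
  -- `G` may miss the range of `ι`. Thickened by the neighbourhoods of `0` it meets that range,
  -- because `π` is open and `G` tends to `0` in `Z`.
  have hK : Cauchy (map (fun p : X × X => p.1 + p.2) (G ×ˢ 𝓝 0)) :=
    (hG.prod cauchy_nhds).map uniformContinuous_add
  set K := map (fun p : X × X => p.1 + p.2) (G ×ˢ 𝓝 0) with hKdef
  have hne : (comap ι K).NeBot := by
    refine comap_neBot fun t ht => ?_
    obtain ⟨A, hA, U, hU, hAU⟩ := mem_prod_iff.1 (mem_map.1 ht)
    have hU' : -U ∈ 𝓝 (0 : X) := neg_mem_nhds_zero X hU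
    have := hG.1
    obtain ⟨a, haA, u, hu, hua⟩ := (((eventually_mem_set.2 hA).and
      (hGπ.eventually_mem (hE.image_mem_nhds_zero hU')))).exists
    obtain ⟨y, hy⟩ := hE.exists_left (x := a + -u) (by rw [map_add, map_neg, hua, add_neg_cancel])
    refine ⟨y, ?_⟩
    rw [hy]
    exact hAU (show (a, -u) ∈ A ×ˢ U from ⟨haA, hu⟩)
  have hu : IsUniformInducing ι := AddMonoidHom.isUniformInducing_of_isInducing hE.isInducing_left
  have hC : Cauchy (comap ι K) := hK.comap hu.comap_uniformity.le
  obtain ⟨y, hy⟩ := CompleteSpace.complete hC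
  have hcl : ClusterPt (ι y) K := by
    have h1 : map ι (comap ι K) ≤ 𝓝 (ι y) ⊓ K :=
      le_inf ((map_mono hy).trans hE.continuous_left.continuousAt) map_comap_le
    exact (hne.map ι).mono h1
  have hKy := le_nhds_of_cauchy_adhp hK hcl
  have hGK : G ≤ K := by
    have h1 : Tendsto (fun x : X => (x, (0 : X))) G (G ×ˢ 𝓝 0) :=
      tendsto_id.prodMk (tendsto_const_nhds (x := (0 : X)))
    have h2 : Tendsto (fun x : X => x + 0) G K := (tendsto_map (f := fun p : X × X => p.1 + p.2)).comp h1
    simpa [Tendsto] using h2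
  refine ⟨ι y + w, ?_⟩
  have h3 : Tendsto (fun x => x - w) F (𝓝 (ι y)) := hGK.trans hKy
  simpa [Tendsto] using h3.add_const w

variable {Y X Z : Type*} [AddCommGroup Y] [Module ℝ Y] [UniformSpace Y]
  [IsUniformAddGroup Y] [ContinuousSMul ℝ Y] [LocallyConvexSpace ℝ Y] [CompleteSpace Y]
  [AddCommGroup X] [TopologicalSpace X] [IsTopologicalAddGroup X] [Module ℚ X]
  [AddCommGroup Z] [Module ℝ Z] [TopologicalSpace Z] [IsTopologicalAddGroup Z]
  [ContinuousSMul ℝ Z] {ι : Y →+ X} {π : X →+ Z}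

theorem exists_tendsto_rat_smul_const (hE : IsTopAddGroupExtension ι π) (c : ℝ) (x : X) :
    ∃ x', Tendsto (fun q : ℚ => q • x) (comap Rat.cast (𝓝 c)) (𝓝 x') := by
  let : UniformSpace X := IsTopologicalAddGroup.rightUniformSpace X
  have : IsUniformAddGroup X := isUniformAddGroup_of_addCommGroup
  have hne : (comap (Rat.cast : ℚ → ℝ) (𝓝 c)).NeBot :=
    Rat.isDenseEmbedding_coe_real.isDenseInducing.comap_nhds_neBot c
  have hc : Tendsto (Rat.cast : ℚ → ℝ) (comap Rat.cast (𝓝 c)) (𝓝 c) := tendsto_comap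
  refine hE.exists_le_nhds_of_cauchy (z := c • π x) ⟨hne.map _, ?_⟩ ?_
  · rw [uniformity_eq_comap_nhds_zero, ← tendsto_iff_comap, prod_map_map_eq, tendsto_map'_iff]
    have h1 : Tendsto (fun p : ℚ × ℚ => ((p.2 - p.1 : ℚ) : ℝ))
        (comap Rat.cast (𝓝 c) ×ˢ comap Rat.cast (𝓝 c)) (𝓝 0) := by
      simpa using (hc.comp tendsto_snd).sub (hc.comp tendsto_fst)
    simpa [Function.comp_def, sub_smul] using hE.tendsto_rat_smul_const h1 x
  · rw [tendsto_map'_iff]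
    simpa [Function.comp_def, AddMonoidHom.map_rat_smul_real] using hc.smul_const (π x)

/-- Split `q • y = q • x + q • (y - x)`: the first term converges, and the second vanishes because
`q` stays bounded. -/
theorem exists_tendsto_rat_smul (hE : IsTopAddGroupExtension ι π) (b : ℝ × X) :
    ∃ x', Tendsto (fun a : ℚ × X => a.1 • a.2) (comap (Prod.map Rat.cast id) (𝓝 b)) (𝓝 x') := by
  obtain ⟨c, x⟩ := b
  obtain ⟨x', hx'⟩ := hE.exists_tendsto_rat_smul_const c x
  have hl : Tendsto (Prod.map Rat.cast id : ℚ × X → ℝ × X)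
      (comap (Prod.map Rat.cast id) (𝓝 (c, x))) (𝓝 (c, x)) := tendsto_comap
  have h1 : Tendsto (fun a : ℚ × X => (a.1 : ℝ)) (comap (Prod.map Rat.cast id) (𝓝 (c, x))) (𝓝 c) :=
    (continuous_fst.tendsto (c, x)).comp hl
  have h2 : Tendsto (fun a : ℚ × X => a.2) (comap (Prod.map Rat.cast id) (𝓝 (c, x))) (𝓝 x) :=
    (continuous_snd.tendsto (c, x)).comp hl
  obtain ⟨N, hN⟩ := exists_nat_gt |c|
  have hb : ∀ᶠ a : ℚ × X in comap (Prod.map Rat.cast id) (𝓝 (c, x)), |a.1| ≤ N := by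
    filter_upwards [h1.abs.eventually_lt_const hN] with a ha
    exact_mod_cast ha.le
  have h3 : Tendsto (fun a : ℚ × X => a.2 - x) (comap (Prod.map Rat.cast id) (𝓝 (c, x))) (𝓝 0) := by
    simpa using h2.sub_const x
  have h4 := (hx'.comp (tendsto_comap_iff.2 h1)).add (hE.tendsto_rat_smul_zero_of_bounded N hb h3)
  refine ⟨x', ?_⟩
  simpa [Function.comp_def, ← smul_add] using h4

/-- The rational scalar multiplication of an extension of a topological vector space by a Fréchet
space extends continuously to real scalars. -/
theorem exists_continuous_smul [T3Space X] (hE : IsTopAddGroupExtension ι π) :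
    ∃ m : ℝ → X → X, Continuous (fun a : ℝ × X => m a.1 a.2) ∧ ∀ (q : ℚ) x, m q x = q • x := by
  have di : IsDenseInducing (Prod.map Rat.cast id : ℚ × X → ℝ × X) :=
    Rat.isDenseEmbedding_coe_real.isDenseInducing.prodMap IsDenseEmbedding.id.isDenseInducing
  refine ⟨fun c x => di.extend (fun a : ℚ × X => a.1 • a.2) (c, x),
    di.continuous_extend hE.exists_tendsto_rat_smul, fun q x => ?_⟩
  exact di.extend_eq' hE.exists_tendsto_rat_smul (q, x)

end Complete

end IsTopAddGroupExtension

/-! ### The extension theorem -/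

theorem theorem5p1 {Y X Z : Type*}
    -- `Y` is a Fréchet space: a complete metrizable locally convex topological vector space
    [AddCommGroup Y] [Module ℝ Y] [UniformSpace Y] [IsUniformAddGroup Y] [ContinuousSMul ℝ Y]
    [LocallyConvexSpace ℝ Y] [TopologicalSpace.MetrizableSpace Y] [CompleteSpace Y]
    -- `X` is a topological abelian group
    [AddCommGroup X] [TopologicalSpace X] [IsTopologicalAddGroup X]
    -- `Z` is a metrizable topological vector space
    [AddCommGroup Z] [Module ℝ Z] [TopologicalSpace Z] [IsTopologicalAddGroup Z]
    [ContinuousSMul ℝ Z] [TopologicalSpace.MetrizableSpace Z]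
    (ι : Y →+ X) (π : X →+ Z) (hE : IsTopAddGroupExtension ι π) :
    -- a vector space structure over the given addition, for the given topology of `X`
    ∃ _ : Module ℝ X, ContinuousSMul ℝ X ∧ TopologicalSpace.MetrizableSpace X ∧
      IsTVSExtension ι π := by
  have : T0Space X := hE.t0Space
  have : TopologicalSpace.MetrizableSpace X := by
    have := hE.isCountablyGenerated_nhds_zero
    let : UniformSpace X := IsTopologicalAddGroup.rightUniformSpace X
    have : IsUniformAddGroup X := isUniformAddGroup_of_addCommGroup
    have := IsUniformAddGroup.uniformity_countably_generated (α := X)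
    exact UniformSpace.metrizableSpace
  let : Module ℚ X := Module.ratOfBijective hE.bijective_zsmul
  obtain ⟨m, hm, hq⟩ := hE.exists_continuous_smul
  let : Module ℝ X := Module.realOfContinuousExtension m hm hq
  have : ContinuousSMul ℝ X := ⟨hm⟩
  -- Continuous additive maps into Hausdorff real topological vector spaces are automatically
  -- real-linear.
  exact ⟨inferInstance, inferInstance, inferInstance, hE,
    map_real_smul ι hE.continuous_left, map_real_smul π hE.continuous_right⟩
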